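/- Let $X$ be a compact metric space, $C(X)$ the continuous real functions and $\mathcal P(X)$ the Borel probability measures on $X$ with the weak$^*$ topology. A functional $\mathcal T:\mathcal P(X)\times\mathcal P(X)\to\mathbb R\cup\{+\infty\}$ that is proper, jointly convex and weak$^*$ lower semi-continuous is called a backward linear transfer if there is a map $T$ from $C(X)$ to the lower semi-continuous real functions on $X$ (its Kantorovich operator) such that $\sup_{\nu\in\mathcal P(X)}\{\int g\,d\nu-\mathcal T(\mu,\nu)\}=\int Tg\,d\mu$ for every $g\in C(X)$ and every $\mu$ for which $\mathcal T(\mu,\cdot)\not\equiv+\infty$. Write $(\mathcal S\star\mathcal T)(\mu,\nu)=\inf_{\sigma\in\mathcal P(X)}\{\mathcal S(\mu,\sigma)+\mathcal T(\sigma,\nu)\}$ and $\mathcal T_n=\mathcal T\star\cdots\star\mathcal T$ ($n$ factors, $n\ge1$). Let $\mathcal T$ be a finite-valued, weak$^*$ continuous backward linear transfer with Kantorovich operator $T$, and suppose that its growth constant $\ell=\lim_{n}\mathcal T_n(\mu,\nu)/n$ (which is independent of $\mu,\nu$) is $0$. Then there is a weak$^*$ lower semi-continuous backward linear transfer $\mathcal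 T_\infty$ with a Kantorovich operator $T_\infty:C(X)\to C(X)$ such that: 1. $T(T_\infty f)=T_\infty f$ and $T_\infty(T_\infty f)=T_\infty f$ for every $f\in C(X)$; moreover, for $f\in C(X)$, $Tf=f$ if and only if $T_\infty f=f$. 2. $\mathcal T_\infty=\mathcal T_n\star\mathcal T_\infty$ for every $n\ge1$, and $\mathcal T_\infty=\mathcal T_\infty\star\mathcal T_\infty$. 3. $\mathcal T_\infty(\mu,\nu)\le\liminf_{n}\mathcal T_n(\mu,\nu)$ for all $\mu,\nu\in\mathcal P(X)$. 4. The set $\mathcal A=\{\mu\in\mathcal P(X):\mathcal T_\infty(\mu,\mu)=0\}$ is non-empty, and for all $\mu,\nu\in\mathcal P(X)$, $\mathcal T_\infty(\mu,\nu)=\inf_{\sigma\in\mathcal A}\{\mathcal T_\infty(\mu,\sigma)+\mathcal T_\infty(\sigma,\nu)\}$, where the infimum is attained. -/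

import Mathlib

open MeasureTheory Filter Topology

noncomputable section

namespace LinearTransfer

/-- A functional `𝒯 : 𝒫(X) × 𝒫(Y) → ℝ ∪ {+∞}` that is proper, jointly convex and jointly lower
semicontinuous for the weak* topology (the topology of `ProbabilityMeasure`). Values are taken in
`EReal`, the value `-∞` being excluded. -/
structure IsProperConvexLSC {X Y : Type*}
    [TopologicalSpace X] [MeasurableSpace X] [OpensMeasurableSpace X]
    [TopologicalSpace Y] [MeasurableSpace Y] [OpensMeasurableSpace Y]
    (𝒯 : ProbabilityMeasure X → ProbabilityMeasure Y → EReal) : Prop where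
  ne_bot : ∀ μ ν, 𝒯 μ ν ≠ ⊥
  proper : ∃ μ ν, 𝒯 μ ν ≠ ⊤
  convex : ∀ a b : NNReal, a + b = 1 →
    ∀ (μ μ₁ μ₂ : ProbabilityMeasure X) (ν ν₁ ν₂ : ProbabilityMeasure Y),
      (μ : Measure X) = a • (μ₁ : Measure X) + b • (μ₂ : Measure X) →
      (ν : Measure Y) = a • (ν₁ : Measure Y) + b • (ν₂ : Measure Y) →
      𝒯 μ ν ≤ ((a : ℝ) : EReal) * 𝒯 μ₁ ν₁ + ((b : ℝ) : EReal) * 𝒯 μ₂ ν₂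
  lsc : LowerSemicontinuous
    (fun p : ProbabilityMeasure X × ProbabilityMeasure Y => 𝒯 p.1 p.2)

/-- The first partial effective domain `D₁(𝒯)`. -/
def firstDomain {X Y : Type*} [MeasurableSpace X] [MeasurableSpace Y]
    (𝒯 : ProbabilityMeasure X → ProbabilityMeasure Y → EReal) : Set (ProbabilityMeasure X) :=
  {μ | ∃ ν, 𝒯 μ ν ≠ ⊤}

/-- The Legendre transform of the partial map `𝒯_μ : ν ↦ 𝒯(μ, ν)`, evaluated at `g ∈ C(Y)`. -/
def legendre {X Y : Type*} [MeasurableSpace X] [TopologicalSpace Y] [MeasurableSpace Y]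
    (𝒯 : ProbabilityMeasure X → ProbabilityMeasure Y → EReal)
    (μ : ProbabilityMeasure X) (g : C(Y, ℝ)) : EReal :=
  ⨆ ν : ProbabilityMeasure Y, ((∫ y, g y ∂(ν : Measure Y) : ℝ) : EReal) - 𝒯 μ ν

/-- `T : C(Y) → LSC(X)` is a backward Kantorovich operator for `𝒯`: for every `μ ∈ D₁(𝒯)` the
Legendre transform of `𝒯_μ` is `g ↦ ∫ T g dμ`. -/
structure IsBackwardKantorovichOperator {X Y : Type*}
    [TopologicalSpace X] [MeasurableSpace X] [TopologicalSpace Y] [MeasurableSpace Y]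
    (𝒯 : ProbabilityMeasure X → ProbabilityMeasure Y → EReal)
    (T : C(Y, ℝ) → X → ℝ) : Prop where
  lsc : ∀ g, LowerSemicontinuous (T g)
  integrable : ∀ μ ∈ firstDomain 𝒯, ∀ g, Integrable (T g) (μ : Measure X)
  legendre_eq : ∀ μ ∈ firstDomain 𝒯, ∀ g,
    legendre 𝒯 μ g = ((∫ x, T g x ∂(μ : Measure X) : ℝ) : EReal)

/-- Backward linear transfers. -/
def IsBackwardLinearTransfer {X Y : Type*}
    [TopologicalSpace X] [MeasurableSpace X] [OpensMeasurableSpace X]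
    [TopologicalSpace Y] [MeasurableSpace Y] [OpensMeasurableSpace Y]
    (𝒯 : ProbabilityMeasure X → ProbabilityMeasure Y → EReal) : Prop :=
  IsProperConvexLSC 𝒯 ∧ ∃ T : C(Y, ℝ) → X → ℝ, IsBackwardKantorovichOperator 𝒯 T

/-- `𝒯` is finite-valued and jointly continuous for the weak* topology. -/
def IsWeakStarContinuous {X Y : Type*}
    [TopologicalSpace X] [MeasurableSpace X] [OpensMeasurableSpace X]
    [TopologicalSpace Y] [MeasurableSpace Y] [OpensMeasurableSpace Y]
    (𝒯 : ProbabilityMeasure X → ProbabilityMeasure Y → EReal) : Prop :=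
  ∃ τ : ProbabilityMeasure X × ProbabilityMeasure Y → ℝ,
    Continuous τ ∧ ∀ μ ν, 𝒯 μ ν = (τ (μ, ν) : EReal)

/-- The inf-convolution `𝒯₁ ⋆ 𝒯₂`. -/
def infConv {X Y Z : Type*} [MeasurableSpace X] [MeasurableSpace Y] [MeasurableSpace Z]
    (𝒯₁ : ProbabilityMeasure X → ProbabilityMeasure Y → EReal)
    (𝒯₂ : ProbabilityMeasure Y → ProbabilityMeasure Z → EReal) :
    ProbabilityMeasure X → ProbabilityMeasure Z → EReal :=
  fun μ ν => ⨅ σ : ProbabilityMeasure Y, 𝒯₁ μ σ + 𝒯₂ σ ν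

open Classical in
/-- The `n`-fold self-convolution `𝒯_n = 𝒯 ⋆ ⋯ ⋆ 𝒯`. (For `n = 0` this is the neutral element
of inf-convolution; only `n ≥ 1` matters.) -/
def selfConv {X : Type*} [MeasurableSpace X]
    (𝒯 : ProbabilityMeasure X → ProbabilityMeasure X → EReal) :
    ℕ → ProbabilityMeasure X → ProbabilityMeasure X → EReal
  | 0 => fun μ ν => if μ = ν then 0 else ⊤
  | 1 => 𝒯
  | n + 2 => infConv (selfConv 𝒯 (n + 1)) 𝒯

/-- `ℓ` is the linear growth rate of the self-convolutions of `𝒯`: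
`𝒯_n(μ, ν) / n → ℓ` for all `μ, ν`. -/
def IsGrowthConstant {X : Type*} [MeasurableSpace X]
    (𝒯 : ProbabilityMeasure X → ProbabilityMeasure X → EReal) (ℓ : ℝ) : Prop :=
  ∀ μ ν, Tendsto (fun n : ℕ => selfConv 𝒯 n μ ν / (n : EReal)) atTop (𝓝 (ℓ : EReal))

/-- The projected Aubry set `{μ ; 𝒯(μ, μ) = 0}`. -/
def aubrySet {X : Type*} [MeasurableSpace X]
    (𝒯 : ProbabilityMeasure X → ProbabilityMeasure X → EReal) : Set (ProbabilityMeasure X) :=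
  {μ | 𝒯 μ μ = 0}

end LinearTransfer

end

open LinearTransfer

/-!
The effective object is an operator on `C(X)`. Since `𝒯` is finite and continuous, its Kantorovich
operator `T` maps `C(X)` to itself, is monotone, convex and commutes with the addition of constants
(`IsKantorovichMap`), and all the functions `T g` share the modulus of continuity
`dist (𝒯 (δ_x, ·)) (𝒯 (δ_y, ·))`. The iterate `T^n` is dual to the `n`-fold self-convolution
(`IsDualTo.selfConv`), so zero growth means that the orbit of `0` neither drifts up nor down, and
with the common modulus it is bounded (`IsDualTo.exists_abs_iterate_zero_le`).

By equicontinuity the upper limit `W g` of `T^n g` is continuous, and monotonicity gives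
`W g ≤ T (W g)`. Hence `T^m (W g)` increases to a fixed point `R g` of `T`, and `R` is again monotone,
convex and compatible with constants; it is the retraction `T_∞` onto the fixed points of `T`
(`IsKantorovichMap.exists_retraction`). The transfer `𝒯_∞` is its dual,
`dualCost R μ ν = sup_g (∫ g dν - ∫ R g dμ)`. As `R g` dominates the upper limit of `T^n g`, this
supremum is at most `liminf 𝒯_n (μ, ν)`, hence finite.

Everything about `𝒯_∞` that asserts the existence of a measure comes from one minimax lemma on the
compact convex set of probability measures, `exists_forall_le_of_forall_exists_le`: attainment in
the Legendre transform, which makes `R` the Kantorovich operator of `𝒯_∞`; the identity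
`𝒯 ⋆ 𝒯_∞ = 𝒯_∞`, from `T ∘ R = R`; and `𝒯_∞ ⋆ 𝒯_∞ = 𝒯_∞`, from `R ∘ R = R`. In each case it is enough
to treat one test function at a time, which is done by a Dirac mass or by duality for `𝒯`.

Finally, splitting `𝒯_∞ (μ, ν)` exactly at an intermediate measure, again and again towards `ν`,
gives an infinite chain along which costs add up while the remaining cost stays bounded. A limit point
`σ` of the chain then satisfies `𝒯_∞ (σ, σ) = 0` and splits `𝒯_∞ (μ, ν)` exactly
(`IsKantorovichMap.exists_dualCost_self_eq_zero`).
-/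

namespace LinearTransfer

/-! ### A minimax lemma -/

/-- Finitely many values `F σ y` can be brought below `c'` simultaneously. Otherwise the constant `c'`
is separated in a finite-dimensional space from the open convex set `C` of strict upper bounds of the
vectors `F σ`, and the separating functional, normalized, is a convex combination of the `y` that
contradicts the hypothesis. -/
theorem exists_forall_mem_lt_of_forall_exists_le {K E : Type*} [AddCommGroup E] [Module ℝ E]
    (F : K → E → ℝ)
    (hconv : ∀ σ τ : K, ∀ a b : ℝ, 0 ≤ a → 0 ≤ b → a + b = 1 →
      ∃ ρ, ∀ y, F ρ y ≤ a * F σ y + b * F τ y)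
    (hconc : ∀ σ, ConcaveOn ℝ Set.univ (F σ)) {c c' : ℝ} (hc : c < c')
    (h : ∀ y, ∃ σ, F σ y ≤ c) (s : Finset E) :
    ∃ σ, ∀ y ∈ s, F σ y < c' := by
  classical
  by_contra hno
  push Not at hno
  obtain ⟨σ₀, -⟩ := h 0
  set C : Set (s → ℝ) := {v | ∃ σ, ∀ i : s, F σ i < v i} with hC
  have hopen : IsOpen C := by
    have : C = ⋃ σ : K, Set.univ.pi fun i : s => Set.Ioi (F σ i) := by
      ext v; simp [hC, Set.mem_pi]
    rw [this]
    exact isOpen_iUnion fun σ => isOpen_set_pi Set.finite_univ fun i _ => isOpen_Ioi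
  have hcvx : Convex ℝ C := by
    rintro v ⟨σ, hσ⟩ w ⟨τ, hτ⟩ a b ha hb hab
    obtain ⟨ρ, hρ⟩ := hconv σ τ a b ha hb hab
    refine ⟨ρ, fun i => (hρ i).trans_lt ?_⟩
    simp only [Pi.add_apply, Pi.smul_apply, smul_eq_mul]
    rcases ha.eq_or_lt with rfl | ha
    · obtain rfl : b = 1 := by linarith
      simpa using hτ i
    · have h1 := mul_lt_mul_of_pos_left (hσ i) ha
      have h2 := mul_le_mul_of_nonneg_left (hτ i).le hb
      linarith
  have hnot : (fun _ => c' : s → ℝ) ∉ C := by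
    rintro ⟨σ, hσ⟩
    obtain ⟨y, hy, hle⟩ := hno σ
    exact absurd (hσ ⟨y, hy⟩) (not_lt.2 hle)
  obtain ⟨f, hf⟩ := geometric_hahn_banach_open_point hcvx hopen hnot
  have hsum : ∀ v : s → ℝ, f v = ∑ i, v i * f (Pi.single i 1) := fun v => by
    refine (LinearMap.pi_apply_eq_sum_univ (f : (s → ℝ) →ₗ[ℝ] ℝ) v).trans
      (Finset.sum_congr rfl fun i _ => ?_)
    have : (fun j => if i = j then 1 else 0 : s → ℝ) = Pi.single i 1 := by
      ext j
      simp [Pi.single_apply, eq_comm]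
    simp [this]
  set p : s → ℝ := fun i => - f (Pi.single i 1) with hp
  have hfp : ∀ v : s → ℝ, f v = - ∑ i, p i * v i := fun v => by
    rw [hsum, ← Finset.sum_neg_distrib]
    exact Finset.sum_congr rfl fun i _ => by simp [hp, mul_comm]
  -- `C` is stable under increasing a coordinate, which forces the weights to be nonnegative.
  have hp0 : ∀ i, 0 ≤ p i := by
    intro i
    by_contra hneg
    push Not at hneg
    set v₀ : s → ℝ := fun j => F σ₀ j + 1 with hv₀
    set t : ℝ := |f (fun _ => c') - f v₀| / (-p i) with ht
    have ht0 : 0 ≤ t := div_nonneg (abs_nonneg _) (by linarith)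
    have hmem : v₀ + t • Pi.single i 1 ∈ C := by
      refine ⟨σ₀, fun j => ?_⟩
      have : 0 ≤ t * (Pi.single i 1 : s → ℝ) j := by
        refine mul_nonneg ht0 ?_
        by_cases hij : j = i
        · subst hij; simp
        · simp [Pi.single_eq_of_ne hij]
      simp only [Pi.add_apply, Pi.smul_apply, smul_eq_mul, hv₀]
      linarith
    have h1 := hf _ hmem
    rw [map_add, map_smul, smul_eq_mul] at h1
    have h2 : t * f (Pi.single i 1) = |f (fun _ => c') - f v₀| := by
      have : f (Pi.single i 1) = - p i := by simp [hp]
      rw [this, ht]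
      field_simp [hneg.ne]
    have := le_abs_self (f (fun _ => c') - f v₀)
    linarith
  have hpsum : 0 < ∑ i, p i := by
    refine lt_of_le_of_ne (Finset.sum_nonneg fun i _ => hp0 i) fun h0 => ?_
    have hz : ∀ i, p i = 0 := fun i =>
      (Finset.sum_eq_zero_iff_of_nonneg fun i _ => hp0 i).1 h0.symm i (Finset.mem_univ i)
    have := hf (fun j => F σ₀ j + 1) ⟨σ₀, fun j => by simp⟩
    simp [hfp, hz] at this
  set P := ∑ i, p i with hP
  obtain ⟨σ, hσ⟩ := h (∑ i : s, (p i / P) • (i : E))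
  have hJ : ∑ i : s, (p i / P) • F σ i ≤ F σ (∑ i : s, (p i / P) • (i : E)) :=
    (hconc σ).le_map_sum (fun i _ => div_nonneg (hp0 i) hpsum.le)
      (by rw [← Finset.sum_div]; exact div_self hpsum.ne') (fun _ _ => Set.mem_univ _)
  have h1 : ∑ i : s, (p i / P) • F σ i ≤ c := hJ.trans hσ
  have h2 : ∑ i : s, p i * F σ i ≤ c * P := by
    have : ∑ i : s, (p i / P) • F σ i = (∑ i : s, p i * F σ i) / P := by
      rw [Finset.sum_div]; exact Finset.sum_congr rfl fun i _ => by simp [div_mul_eq_mul_div]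
    rwa [this, div_le_iff₀ hpsum] at h1
  have h3 := hf (fun i => F σ i + (c' - c)) ⟨σ, fun i => by linarith⟩
  simp only [hfp, mul_add, Finset.sum_add_distrib, ← Finset.sum_mul] at h3
  rw [← hP] at h3
  nlinarith

/-- A minimax lemma. The space `K` carries no linear structure: convexity in the first variable is
replaced by the existence, for each convex combination of values, of a point doing at least as well,
so that `K` can be a space of probability measures. -/
theorem exists_forall_le_of_forall_exists_le {K E : Type*} [TopologicalSpace K] [CompactSpace K]
    [AddCommGroup E] [Module ℝ E] (F : K → E → ℝ)
    (hlsc : ∀ y, LowerSemicontinuous fun σ => F σ y)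
    (hconv : ∀ σ τ : K, ∀ a b : ℝ, 0 ≤ a → 0 ≤ b → a + b = 1 →
      ∃ ρ, ∀ y, F ρ y ≤ a * F σ y + b * F τ y)
    (hconc : ∀ σ, ConcaveOn ℝ Set.univ (F σ)) {c : ℝ}
    (h : ∀ y, ∃ σ, F σ y ≤ c) :
    ∃ σ, ∀ y, F σ y ≤ c := by
  have hcl : ∀ d y, IsClosed {σ | F σ y ≤ d} := fun d y => (hlsc y).isClosed_preimage d
  have key : ∀ c', c < c' → (⋂ y, {σ | F σ y ≤ c'}).Nonempty := by
    intro c' hc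
    have := (isCompact_univ (X := K)).inter_iInter_nonempty (fun y : E => {σ | F σ y ≤ c'})
      (hcl c') (fun u => ?_)
    · simpa using this
    · obtain ⟨σ, hσ⟩ := exists_forall_mem_lt_of_forall_exists_le F hconv hconc hc h u
      exact ⟨σ, trivial, Set.mem_iInter₂.2 fun y hy => (hσ y hy).le⟩
  have hne := IsCompact.nonempty_iInter_of_sequence_nonempty_isCompact_isClosed
    (fun n : ℕ => ⋂ y, {σ | F σ y ≤ c + 1 / ((n : ℝ) + 1)})
    (fun n => Set.iInter_mono fun y σ hσ => by
      have : 1 / (((n + 1 : ℕ) : ℝ) + 1) ≤ 1 / ((n : ℝ) + 1) :=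
        one_div_le_one_div_of_le (by positivity) (by push_cast; linarith)
      exact le_trans (show F σ y ≤ _ from hσ) (by linarith))
    (fun n => key _ (by have : 0 < 1 / ((n : ℝ) + 1) := by positivity
                        linarith))
    (isClosed_iInter fun y => hcl _ y).isCompact
    (fun n => isClosed_iInter fun y => hcl _ y)
  obtain ⟨σ, hσ⟩ := hne
  refine ⟨σ, fun y => ?_⟩
  have hlim : Tendsto (fun n : ℕ => c + 1 / ((n : ℝ) + 1)) atTop (𝓝 (c + 0)) :=
    tendsto_const_nhds.add tendsto_one_div_add_atTop_nhds_zero_nat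
  rw [add_zero] at hlim
  exact ge_of_tendsto' hlim fun n => Set.mem_iInter.1 (Set.mem_iInter.1 hσ n) y

/-! ### Kantorovich maps and their dual costs -/

theorem exists_probabilityMeasure_eq_add {X : Type*} [MeasurableSpace X] {a b : NNReal}
    (hab : a + b = 1) (μ ν : ProbabilityMeasure X) :
    ∃ σ : ProbabilityMeasure X, (σ : Measure X) = a • (μ : Measure X) + b • (ν : Measure X) := by
  refine ⟨⟨a • (μ : Measure X) + b • (ν : Measure X), ⟨?_⟩⟩, rfl⟩
  have : (a : ENNReal) + b = 1 := by exact_mod_cast hab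
  rw [Measure.add_apply, Measure.smul_apply, Measure.smul_apply, measure_univ, measure_univ]
  simp only [ENNReal.smul_def, smul_eq_mul, mul_one]
  exact this

theorem toMeasure_eq_add_self {X : Type*} [MeasurableSpace X] {a b : NNReal} (hab : a + b = 1)
    (μ : ProbabilityMeasure X) :
    (μ : Measure X) = a • (μ : Measure X) + b • (μ : Measure X) := by
  rw [← add_smul, hab, one_smul]

/-- The largest translate of `g` below `f` touches `f`. -/
theorem exists_add_const_le {X : Type*} [TopologicalSpace X] [CompactSpace X] [Nonempty X]
    (f g : C(X, ℝ)) : ∃ x, g + ContinuousMap.const X (f x - g x) ≤ f := by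
  obtain ⟨x, -, hx⟩ := isCompact_univ.exists_isMinOn Set.univ_nonempty
    (f - g).continuous.continuousOn
  refine ⟨x, ContinuousMap.le_def.2 fun y => ?_⟩
  have : f x - g x ≤ f y - g y := hx (Set.mem_univ y)
  simp only [ContinuousMap.add_apply, ContinuousMap.const_apply]
  linarith

theorem integral_continuousMap_smul {X : Type*} [TopologicalSpace X] [MeasurableSpace X]
    (μ : ProbabilityMeasure X) (a : ℝ) (g : C(X, ℝ)) :
    ∫ x, (a • g) x ∂(μ : Measure X) = a * ∫ x, g x ∂(μ : Measure X) :=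
  integral_const_mul a _

theorem integral_continuousMap_const {X : Type*} [TopologicalSpace X] [MeasurableSpace X]
    (μ : ProbabilityMeasure X) (c : ℝ) :
    ∫ x, (ContinuousMap.const X c) x ∂(μ : Measure X) = c := by
  simp

section

variable {X : Type*} [TopologicalSpace X]

/-- The order-theoretic properties of the Kantorovich operator of a linear transfer. -/
structure IsKantorovichMap (P : C(X, ℝ) → C(X, ℝ)) : Prop where
  mono : Monotone P
  add_const : ∀ g c, P (g + ContinuousMap.const X c) = P g + ContinuousMap.const X c
  convex : ∀ (a b : ℝ) (g h : C(X, ℝ)), 0 ≤ a → 0 ≤ b → a + b = 1 →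
    P (a • g + b • h) ≤ a • P g + b • P h

variable [MeasurableSpace X] {P Q : C(X, ℝ) → C(X, ℝ)}

/-- The quantity `∫ g dν - ∫ P g dμ` whose supremum over `g` is the transfer dual to `P`. -/
noncomputable def dualGap (P : C(X, ℝ) → C(X, ℝ)) (μ ν : ProbabilityMeasure X) (g : C(X, ℝ)) : ℝ :=
  ∫ x, g x ∂(ν : Measure X) - ∫ x, P g x ∂(μ : Measure X)

/-- The transfer dual to `P`, as a real-valued functional; it is meaningful when the gaps
`dualGap P μ ν g` are bounded above in `g`. -/
noncomputable def dualCost (P : C(X, ℝ) → C(X, ℝ)) (μ ν : ProbabilityMeasure X) : ℝ :=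
  ⨆ g, dualGap P μ ν g

theorem dualGap_le_dualCost {μ ν : ProbabilityMeasure X}
    (hB : BddAbove (Set.range (dualGap P μ ν))) (g : C(X, ℝ)) :
    dualGap P μ ν g ≤ dualCost P μ ν :=
  le_ciSup hB g

theorem dualCost_le {μ ν : ProbabilityMeasure X} {r : ℝ} (h : ∀ g, dualGap P μ ν g ≤ r) :
    dualCost P μ ν ≤ r :=
  ciSup_le h

theorem dualGap_comp (μ σ ν : ProbabilityMeasure X) (g : C(X, ℝ)) :
    dualGap (P ∘ Q) μ ν g = dualGap P μ σ (Q g) + dualGap Q σ ν g := by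
  simp only [dualGap, Function.comp]
  ring

theorem dualGap_zero (μ ν : ProbabilityMeasure X) :
    dualGap P μ ν 0 = -∫ x, P 0 x ∂(μ : Measure X) := by
  simp [dualGap]

theorem dualCost_triangle (hPP : ∀ f, P (P f) = P f)
    (hB : ∀ μ ν, BddAbove (Set.range (dualGap P μ ν))) (μ σ ν : ProbabilityMeasure X) :
    dualCost P μ ν ≤ dualCost P μ σ + dualCost P σ ν := by
  refine dualCost_le fun g => ?_
  have h1 := dualGap_le_dualCost (hB μ σ) (P g)
  have h2 := dualGap_le_dualCost (hB σ ν) g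
  simp only [dualGap, hPP] at *
  linarith

theorem dualCost_self_nonneg (hPP : ∀ f, P (P f) = P f)
    (hB : ∀ μ ν, BddAbove (Set.range (dualGap P μ ν))) (μ : ProbabilityMeasure X) :
    0 ≤ dualCost P μ μ := by
  have := dualGap_le_dualCost (hB μ μ) (P 0)
  rwa [dualGap, hPP, sub_self] at this

end

section

variable {X : Type*} [TopologicalSpace X] [CompactSpace X] [MeasurableSpace X]
  [OpensMeasurableSpace X] {P : C(X, ℝ) → C(X, ℝ)}

theorem integrable_continuousMap (μ : ProbabilityMeasure X) (g : C(X, ℝ)) :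
    Integrable g (μ : Measure X) :=
  g.continuous.integrable_of_hasCompactSupport (HasCompactSupport.of_compactSpace _)

theorem integral_continuousMap_mono (μ : ProbabilityMeasure X) {g h : C(X, ℝ)} (hgh : g ≤ h) :
    ∫ x, g x ∂(μ : Measure X) ≤ ∫ x, h x ∂(μ : Measure X) :=
  integral_mono (integrable_continuousMap μ g) (integrable_continuousMap μ h) hgh

theorem integral_continuousMap_add (μ : ProbabilityMeasure X) (g h : C(X, ℝ)) :
    ∫ x, (g + h) x ∂(μ : Measure X)
      = ∫ x, g x ∂(μ : Measure X) + ∫ x, h x ∂(μ : Measure X) :=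
  integral_add (integrable_continuousMap μ g) (integrable_continuousMap μ h)

theorem integral_continuousMap_of_eq_add {a b : NNReal} {σ μ ν : ProbabilityMeasure X}
    (h : (σ : Measure X) = a • (μ : Measure X) + b • (ν : Measure X)) (g : C(X, ℝ)) :
    ∫ x, g x ∂(σ : Measure X)
      = a * ∫ x, g x ∂(μ : Measure X) + b * ∫ x, g x ∂(ν : Measure X) := by
  rw [h, integral_add_measure ((integrable_continuousMap μ g).smul_measure_nnreal)
    ((integrable_continuousMap ν g).smul_measure_nnreal), integral_smul_nnreal_measure,
    integral_smul_nnreal_measure]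
  rfl

theorem IsKantorovichMap.concaveOn_dualGap (hP : IsKantorovichMap P)
    (μ ν : ProbabilityMeasure X) : ConcaveOn ℝ Set.univ (dualGap P μ ν) := by
  refine ⟨convex_univ, fun g _ h _ a b ha hb hab => ?_⟩
  have := integral_continuousMap_mono μ (hP.convex a b g h ha hb hab)
  simp only [integral_continuousMap_add, integral_continuousMap_smul] at this
  simp only [dualGap, integral_continuousMap_add, integral_continuousMap_smul, smul_eq_mul]
  linarith

theorem continuous_dualGap (g : C(X, ℝ)) :
    Continuous fun p : ProbabilityMeasure X × ProbabilityMeasure X => dualGap P p.1 p.2 g :=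
  ((ProbabilityMeasure.continuous_integral_continuousMap g).comp continuous_snd).sub
    ((ProbabilityMeasure.continuous_integral_continuousMap (P g)).comp continuous_fst)

theorem dualGap_of_eq_add {a b : NNReal} {μ μ₁ μ₂ ν ν₁ ν₂ : ProbabilityMeasure X}
    (hμ : (μ : Measure X) = a • (μ₁ : Measure X) + b • (μ₂ : Measure X))
    (hν : (ν : Measure X) = a • (ν₁ : Measure X) + b • (ν₂ : Measure X)) (g : C(X, ℝ)) :
    dualGap P μ ν g = a * dualGap P μ₁ ν₁ g + b * dualGap P μ₂ ν₂ g := by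
  simp only [dualGap, integral_continuousMap_of_eq_add hμ, integral_continuousMap_of_eq_add hν]
  ring

/-- Every convex combination of probability measures is realized by a probability measure, so that
a functional which is affine in the measure is convex-like in the sense of the minimax lemma. -/
theorem exists_dualGap_right_eq (μ ν₁ ν₂ : ProbabilityMeasure X) {a b : ℝ} (ha : 0 ≤ a)
    (hb : 0 ≤ b) (hab : a + b = 1) :
    ∃ ν : ProbabilityMeasure X,
      ∀ g, dualGap P μ ν g = a * dualGap P μ ν₁ g + b * dualGap P μ ν₂ g := by
  lift a to NNReal using ha
  lift b to NNReal using hb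
  have hab : a + b = 1 := by exact_mod_cast hab
  obtain ⟨ν, hν⟩ := exists_probabilityMeasure_eq_add hab ν₁ ν₂
  exact ⟨ν, dualGap_of_eq_add (toMeasure_eq_add_self hab μ) hν⟩

theorem integral_diracProba (x : X) (g : C(X, ℝ)) :
    ∫ y, g y ∂(diracProba x : Measure X) = g x :=
  integral_dirac' _ _ (g.continuous.stronglyMeasurable_of_hasCompactSupport
    (HasCompactSupport.of_compactSpace _))

end

/-! ### The transfer dual to a Kantorovich map -/

section

variable {X : Type*} [MetricSpace X] [CompactSpace X] [MeasurableSpace X] [BorelSpace X]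
  {P : C(X, ℝ) → C(X, ℝ)}

/-- The Legendre transform of the dual cost is attained: a subgradient of `g ↦ ∫ P g dμ` exists and
is a probability measure. The minimax lemma reduces this to finding, for a single competitor `f`, a
measure that does at least as well with `g`, and a Dirac mass at a minimum point of `f - g` does. -/
theorem IsKantorovichMap.exists_forall_dualGap_le (hP : IsKantorovichMap P)
    (μ : ProbabilityMeasure X) (g : C(X, ℝ)) :
    ∃ ν, ∀ f, dualGap P μ ν f ≤ dualGap P μ ν g := by
  have := μ.nonempty
  have key := exists_forall_le_of_forall_exists_le (c := 0)
    (fun (ν : ProbabilityMeasure X) (f : C(X, ℝ)) => dualGap P μ ν f - dualGap P μ ν g)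
    (fun f => (((continuous_dualGap f).sub (continuous_dualGap g)).comp
      (Continuous.prodMk_right μ)).lowerSemicontinuous)
    (fun ν₁ ν₂ a b ha hb hab => by
      obtain ⟨ν, hν⟩ := exists_dualGap_right_eq (P := P) μ ν₁ ν₂ ha hb hab
      exact ⟨ν, fun f => by rw [hν, hν]; linarith⟩)
    (fun ν => (hP.concaveOn_dualGap μ ν).add_const (-dualGap P μ ν g))
    (fun f => by
      obtain ⟨x, hle⟩ := exists_add_const_le f g
      refine ⟨diracProba x, ?_⟩
      have := integral_continuousMap_mono μ (hP.mono hle)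
      rw [hP.add_const, integral_continuousMap_add, integral_continuousMap_const] at this
      simp only [dualGap, integral_diracProba]
      linarith)
  obtain ⟨ν, hν⟩ := key
  exact ⟨ν, fun f => by linarith [hν f]⟩

theorem IsKantorovichMap.legendre_dualCost (hP : IsKantorovichMap P)
    (hB : ∀ μ ν, BddAbove (Set.range (dualGap P μ ν))) (μ : ProbabilityMeasure X) (g : C(X, ℝ)) :
    legendre (fun μ ν => (dualCost P μ ν : EReal)) μ g
      = ((∫ x, P g x ∂(μ : Measure X) : ℝ) : EReal) := by
  refine le_antisymm (iSup_le fun ν => ?_) ?_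
  · have := dualGap_le_dualCost (hB μ ν) g
    rw [dualGap] at this
    rw [← EReal.coe_sub, EReal.coe_le_coe_iff]
    linarith
  · obtain ⟨ν, hν⟩ := hP.exists_forall_dualGap_le μ g
    refine le_trans ?_ (le_iSup _ ν)
    have : dualCost P μ ν ≤ dualGap P μ ν g := dualCost_le hν
    rw [dualGap] at this
    rw [← EReal.coe_sub, EReal.coe_le_coe_iff]
    linarith

theorem IsKantorovichMap.isBackwardKantorovichOperator_dualCost (hP : IsKantorovichMap P)
    (hB : ∀ μ ν, BddAbove (Set.range (dualGap P μ ν))) :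
    IsBackwardKantorovichOperator (fun μ ν => (dualCost P μ ν : EReal)) (fun g => ⇑(P g)) where
  lsc g := (P g).continuous.lowerSemicontinuous
  integrable μ _ g := integrable_continuousMap μ (P g)
  legendre_eq μ _ g := hP.legendre_dualCost hB μ g

theorem isProperConvexLSC_dualCost [Nonempty X]
    (hB : ∀ μ ν, BddAbove (Set.range (dualGap P μ ν))) :
    IsProperConvexLSC (fun μ ν => (dualCost P μ ν : EReal)) where
  ne_bot μ ν := EReal.coe_ne_bot _
  proper := ⟨diracProba (Classical.arbitrary X), diracProba (Classical.arbitrary X),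
    EReal.coe_ne_top _⟩
  convex a b _ μ μ₁ μ₂ ν ν₁ ν₂ hμ hν := by
    rw [← EReal.coe_mul, ← EReal.coe_mul, ← EReal.coe_add, EReal.coe_le_coe_iff]
    refine dualCost_le fun g => ?_
    rw [dualGap_of_eq_add hμ hν]
    exact add_le_add
      (mul_le_mul_of_nonneg_left (dualGap_le_dualCost (hB _ _) g) a.coe_nonneg)
      (mul_le_mul_of_nonneg_left (dualGap_le_dualCost (hB _ _) g) b.coe_nonneg)
  lsc := by
    have h : LowerSemicontinuous fun p : ProbabilityMeasure X × ProbabilityMeasure X =>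
        dualCost P p.1 p.2 :=
      lowerSemicontinuous_ciSup (fun p => hB p.1 p.2)
        fun g => (continuous_dualGap g).lowerSemicontinuous
    exact continuous_coe_real_ereal.comp_lowerSemicontinuous h fun _ _ hab =>
      EReal.coe_le_coe_iff.2 hab

/-- Joint lower semicontinuity of the dual cost, along an arbitrary filter and with moving bounds. -/
theorem dualCost_le_of_tendsto {ι : Type*} {l : Filter ι} [l.NeBot]
    (hB : ∀ μ ν, BddAbove (Set.range (dualGap P μ ν)))
    {μ ν : ι → ProbabilityMeasure X} {μ₀ ν₀ : ProbabilityMeasure X} {r : ι → ℝ} {r₀ : ℝ}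
    (hμ : Tendsto μ l (𝓝 μ₀)) (hν : Tendsto ν l (𝓝 ν₀)) (hr : Tendsto r l (𝓝 r₀))
    (h : ∀ᶠ i in l, dualCost P (μ i) (ν i) ≤ r i) : dualCost P μ₀ ν₀ ≤ r₀ :=
  dualCost_le fun g => le_of_tendsto_of_tendsto
    (((continuous_dualGap g).tendsto (μ₀, ν₀)).comp (hμ.prodMk_nhds hν)) hr
    (h.mono fun _ hi => (dualGap_le_dualCost (hB _ _) g).trans hi)

/-! ### Idempotent Kantorovich maps and their Aubry sets -/

/-- Equality in the triangle inequality holds at some intermediate measure. -/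
theorem IsKantorovichMap.exists_dualCost_add_eq (hP : IsKantorovichMap P)
    (hPP : ∀ f, P (P f) = P f) (hB : ∀ μ ν, BddAbove (Set.range (dualGap P μ ν)))
    (μ ν : ProbabilityMeasure X) :
    ∃ σ, dualCost P μ σ + dualCost P σ ν = dualCost P μ ν := by
  have := μ.nonempty
  have key := exists_forall_le_of_forall_exists_le (c := dualCost P μ ν)
    (fun (σ : ProbabilityMeasure X) (p : C(X, ℝ) × C(X, ℝ)) =>
      dualGap P μ σ p.1 + dualGap P σ ν p.2)
    (fun p => (((continuous_dualGap p.1).comp (Continuous.prodMk_right μ)).add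
      ((continuous_dualGap p.2).comp (Continuous.prodMk_left ν))).lowerSemicontinuous)
    (fun σ₁ σ₂ a b ha hb hab => by
      lift a to NNReal using ha
      lift b to NNReal using hb
      have hab : a + b = 1 := by exact_mod_cast hab
      obtain ⟨σ, hσ⟩ := exists_probabilityMeasure_eq_add hab σ₁ σ₂
      refine ⟨σ, fun p => ?_⟩
      rw [dualGap_of_eq_add (toMeasure_eq_add_self hab μ) hσ,
        dualGap_of_eq_add hσ (toMeasure_eq_add_self hab ν)]
      linarith)
    (fun σ => ((hP.concaveOn_dualGap μ σ).comp_linearMap (LinearMap.fst ℝ _ _)).add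
      ((hP.concaveOn_dualGap σ ν).comp_linearMap (LinearMap.snd ℝ _ _)))
    -- At a minimum point of `h - P g`, the pair `(h, g)` does no better than `g` between `μ` and `ν`,
    -- because `P h ≥ P (P g) + (h x - P g x)`.
    (fun p => by
      obtain ⟨x, hle⟩ := exists_add_const_le p.1 (P p.2)
      refine ⟨diracProba x, ?_⟩
      have h1 := integral_continuousMap_mono μ (hP.mono hle)
      rw [hP.add_const, hPP, integral_continuousMap_add, integral_continuousMap_const] at h1
      have h2 := dualGap_le_dualCost (hB μ ν) p.2
      simp only [dualGap, integral_diracProba] at *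
      linarith)
  obtain ⟨σ, hσ⟩ := key
  refine ⟨σ, le_antisymm ?_ (dualCost_triangle hPP hB μ σ ν)⟩
  have h1 : ∀ g, dualCost P μ σ ≤ dualCost P μ ν - dualGap P σ ν g := fun g =>
    dualCost_le fun h => by linarith [hσ (h, g)]
  have h2 : dualCost P σ ν ≤ dualCost P μ ν - dualCost P μ σ :=
    dualCost_le fun g => by linarith [h1 g]
  linarith

/-- Comparison with the test function `0`. -/
theorem neg_norm_le_dualCost (hB : ∀ μ ν, BddAbove (Set.range (dualGap P μ ν)))
    (μ ν : ProbabilityMeasure X) : -‖P 0‖ ≤ dualCost P μ ν := by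
  refine le_trans ?_ (dualGap_le_dualCost (hB μ ν) 0)
  have := integral_continuousMap_mono μ (g := P 0) (h := ContinuousMap.const X ‖P 0‖)
    fun x => (P 0).apply_le_norm x
  rw [integral_continuousMap_const] at this
  simp only [dualGap, ContinuousMap.zero_apply, integral_zero]
  linarith

/-- Any transition from `μ` to `ν` can be routed through the Aubry set at no extra cost. Iterating
exact midpoints produces an infinite chain from `μ` towards `ν` along which costs add up; since the
remaining costs `b n` stay bounded, a limit point of the chain has zero cost to itself. -/
theorem IsKantorovichMap.exists_dualCost_self_eq_zero (hP : IsKantorovichMap P)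
    (hPP : ∀ f, P (P f) = P f) (hB : ∀ μ ν, BddAbove (Set.range (dualGap P μ ν)))
    (μ ν : ProbabilityMeasure X) :
    ∃ σ, dualCost P σ σ = 0 ∧ dualCost P μ σ + dualCost P σ ν = dualCost P μ ν := by
  choose next hnext using fun σ => hP.exists_dualCost_add_eq hPP hB σ ν
  set s : ℕ → ProbabilityMeasure X := fun n => next^[n] μ with hs
  set b : ℕ → ℝ := fun n => dualCost P (s n) ν with hb
  have hstep : ∀ n, dualCost P (s n) (s (n + 1)) = b n - b (n + 1) := fun n => by
    have := hnext (s n)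
    have h2 : next (s n) = s (n + 1) := (Function.iterate_succ_apply' next n μ).symm
    rw [h2] at this
    simp only [hb]
    linarith
  have hchain : ∀ i k, dualCost P (s i) (s (i + k + 1)) ≤ b i - b (i + k + 1) := by
    intro i k
    induction k with
    | zero => exact (hstep i).le
    | succ k ih =>
      have h1 := dualCost_triangle hPP hB (s i) (s (i + k + 1)) (s (i + k + 1 + 1))
      have h2 := hstep (i + k + 1)
      rw [← add_assoc i k 1]
      linarith
  have hlt : ∀ i j, i < j → dualCost P (s i) (s j) ≤ b i - b j := by
    intro i j hij
    obtain ⟨k, rfl⟩ := Nat.exists_eq_add_of_lt hij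
    exact hchain i k
  have hbmem : ∀ n, b n ∈ Set.Icc (-‖P 0‖) (b 0 + ‖P 0‖) := by
    intro n
    refine ⟨neg_norm_le_dualCost hB _ _, ?_⟩
    rcases n.eq_zero_or_pos with rfl | hn
    · linarith [norm_nonneg (P 0)]
    · linarith [hlt 0 n hn, neg_norm_le_dualCost hB (s 0) (s n)]
  set U : Ultrafilter ℕ := hyperfilter ℕ with hU
  have hUat : (U : Filter ℕ) ≤ atTop := Nat.cofinite_eq_atTop ▸ hyperfilter_le_cofinite
  obtain ⟨σ, -, hσ⟩ := isCompact_univ.ultrafilter_le_nhds (U.map s) (by simp)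
  obtain ⟨β, -, hβ⟩ := isCompact_Icc.ultrafilter_le_nhds (U.map b)
    (le_principal_iff.2 (show ∀ᶠ n in (U : Filter ℕ), b n ∈ _ from Eventually.of_forall hbmem))
  have hσ : Tendsto s U (𝓝 σ) := hσ
  have hβ : Tendsto b U (𝓝 β) := hβ
  -- Letting the second index tend to the limit before the first avoids a diagonal argument.
  have h1 : ∀ i, dualCost P (s i) σ ≤ b i - β := fun i =>
    dualCost_le_of_tendsto hB tendsto_const_nhds hσ (tendsto_const_nhds.sub hβ)
      (hUat ((eventually_gt_atTop i).mono fun j hj => hlt i j hj))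
  have h2 : dualCost P σ σ ≤ β - β :=
    dualCost_le_of_tendsto hB hσ tendsto_const_nhds (hβ.sub tendsto_const_nhds)
      (Eventually.of_forall h1)
  have h3 : dualCost P σ ν ≤ β :=
    dualCost_le_of_tendsto hB hσ tendsto_const_nhds hβ (Eventually.of_forall fun _ => le_rfl)
  refine ⟨σ, le_antisymm (by linarith) (dualCost_self_nonneg hPP hB σ),
    le_antisymm ?_ (dualCost_triangle hPP hB μ σ ν)⟩
  have h4 : dualCost P μ σ ≤ dualCost P μ ν - β := h1 0
  linarith

end

/-! ### Retraction onto the fixed points of a Kantorovich map -/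

section

variable {X : Type*} [TopologicalSpace X]

theorem isKantorovichMap_id : IsKantorovichMap (id : C(X, ℝ) → C(X, ℝ)) where
  mono := monotone_id
  add_const _ _ := rfl
  convex _ _ _ _ _ _ _ := le_rfl

theorem IsKantorovichMap.comp {P Q : C(X, ℝ) → C(X, ℝ)} (hP : IsKantorovichMap P)
    (hQ : IsKantorovichMap Q) : IsKantorovichMap (P ∘ Q) where
  mono := hP.mono.comp hQ.mono
  add_const g c := by simp [hQ.add_const, hP.add_const]
  convex a b g h ha hb hab :=
    (hP.mono (hQ.convex a b g h ha hb hab)).trans (hP.convex a b _ _ ha hb hab)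

theorem IsKantorovichMap.iterate {P : C(X, ℝ) → C(X, ℝ)} (hP : IsKantorovichMap P) (n : ℕ) :
    IsKantorovichMap P^[n] := by
  induction n with
  | zero => exact isKantorovichMap_id
  | succ n ih => rw [Function.iterate_succ]; exact ih.comp hP

theorem IsKantorovichMap.iterate_zero_le {P : C(X, ℝ) → C(X, ℝ)}
    (hP : IsKantorovichMap P) {m : ℝ}
    (h : P 0 ≤ ContinuousMap.const X m) (k : ℕ) :
    P^[k] 0 ≤ ContinuousMap.const X (k * m) := by
  induction k with
  | zero => exact ContinuousMap.le_def.2 fun x => by simp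
  | succ k ih =>
    rw [Function.iterate_succ_apply']
    have h1 := hP.mono ih
    rw [← zero_add (ContinuousMap.const X (k * m)), hP.add_const] at h1
    refine ContinuousMap.le_def.2 fun x => ?_
    have h2 := ContinuousMap.le_def.1 h1 x
    have h3 := ContinuousMap.le_def.1 h x
    simp only [ContinuousMap.add_apply, ContinuousMap.const_apply] at h2 h3 ⊢
    push_cast
    linarith

theorem IsKantorovichMap.le_iterate_zero {P : C(X, ℝ) → C(X, ℝ)}
    (hP : IsKantorovichMap P) {m : ℝ}
    (h : ContinuousMap.const X m ≤ P 0) (k : ℕ) :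
    ContinuousMap.const X (k * m) ≤ P^[k] 0 := by
  induction k with
  | zero => exact ContinuousMap.le_def.2 fun x => by simp
  | succ k ih =>
    rw [Function.iterate_succ_apply']
    have h1 := hP.mono ih
    rw [← zero_add (ContinuousMap.const X (k * m)), hP.add_const] at h1
    refine ContinuousMap.le_def.2 fun x => ?_
    have h2 := ContinuousMap.le_def.1 h1 x
    have h3 := ContinuousMap.le_def.1 h x
    simp only [ContinuousMap.add_apply, ContinuousMap.const_apply] at h2 h3 ⊢
    push_cast
    linarith

/-- A pointwise limit of Kantorovich maps is a Kantorovich map. -/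
theorem IsKantorovichMap.of_tendsto {Q : ℕ → C(X, ℝ) → C(X, ℝ)} {R : C(X, ℝ) → C(X, ℝ)}
    (hQ : ∀ n, IsKantorovichMap (Q n))
    (hR : ∀ g x, Tendsto (fun n => Q n g x) atTop (𝓝 (R g x))) : IsKantorovichMap R where
  mono g h hgh x := le_of_tendsto_of_tendsto' (hR g x) (hR h x) fun n => (hQ n).mono hgh x
  add_const g c := by
    ext x
    refine tendsto_nhds_unique (hR _ x) ?_
    simp only [(hQ _).add_const]
    exact (hR g x).add_const c
  convex a b g h ha hb hab x :=
    le_of_tendsto_of_tendsto' (hR _ x) (((hR g x).const_mul a).add ((hR h x).const_mul b))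
      fun n => (hQ n).convex a b g h ha hb hab x

/-- A pointwise supremum of Kantorovich maps is a Kantorovich map. -/
theorem IsKantorovichMap.of_isLUB {ι : Type*} {Q : ι → C(X, ℝ) → C(X, ℝ)}
    {R : C(X, ℝ) → C(X, ℝ)} (hQ : ∀ i, IsKantorovichMap (Q i))
    (hR : ∀ g x, IsLUB (Set.range fun i => Q i g x) (R g x)) : IsKantorovichMap R where
  mono g h hgh x := (hR g x).2 <| by
    rintro _ ⟨i, rfl⟩
    exact ((hQ i).mono hgh x).trans ((hR h x).1 ⟨i, rfl⟩)
  add_const g c := by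
    ext x
    refine (hR _ x).unique ?_
    simp only [(hQ _).add_const, ContinuousMap.add_apply, ContinuousMap.const_apply]
    have := (OrderIso.addRight c).isLUB_image'.2 (hR g x)
    rwa [← Set.range_comp] at this
  convex a b g h ha hb hab x := (hR _ x).2 <| by
    rintro _ ⟨i, rfl⟩
    refine ((hQ i).convex a b g h ha hb hab x).trans ?_
    exact add_le_add (mul_le_mul_of_nonneg_left ((hR g x).1 ⟨i, rfl⟩) ha)
      (mul_le_mul_of_nonneg_left ((hR h x).1 ⟨i, rfl⟩) hb)

theorem le_of_tendsto_continuousMap {F G : ℕ → C(X, ℝ)} {f g : C(X, ℝ)}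
    (hF : Tendsto F atTop (𝓝 f)) (hG : Tendsto G atTop (𝓝 g)) (h : ∀ n, F n ≤ G n) : f ≤ g :=
  ContinuousMap.le_def.2 fun x => le_of_tendsto_of_tendsto'
    (((continuous_eval_const x).tendsto f).comp hF)
    (((continuous_eval_const x).tendsto g).comp hG) fun n => h n x

variable {Z : Type*} [PseudoMetricSpace Z] {κ : X → Z}

theorem continuous_of_sub_le_dist (hκ : Continuous κ) {f : X → ℝ}
    (hf : ∀ x y, f x - f y ≤ dist (κ x) (κ y)) : Continuous f := by
  refine continuous_iff_continuousAt.2 fun y => tendsto_iff_dist_tendsto_zero.2 ?_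
  refine squeeze_zero (fun _ => dist_nonneg) (fun x => ?_)
    (tendsto_iff_dist_tendsto_zero.1 (hκ.tendsto y))
  rw [Real.dist_eq, abs_sub_le_iff]
  exact ⟨hf x y, dist_comm (κ x) (κ y) ▸ hf y x⟩

theorem exists_isLUB_of_equicontinuous (hκ : Continuous κ) {Q : ℕ → C(X, ℝ) → C(X, ℝ)}
    (hQ : ∀ n, IsKantorovichMap (Q n))
    (hmod : ∀ n g x y, Q n g x - Q n g y ≤ dist (κ x) (κ y))
    (hbdd : ∀ g, ∃ B, ∀ n x, Q n g x ≤ B) :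
    ∃ R : C(X, ℝ) → C(X, ℝ), IsKantorovichMap R ∧
      (∀ g x y, R g x - R g y ≤ dist (κ x) (κ y)) ∧
      ∀ g x, IsLUB (Set.range fun n => Q n g x) (R g x) := by
  have hlub : ∀ g x, IsLUB (Set.range fun n => Q n g x) (⨆ n, Q n g x) := fun g x => by
    obtain ⟨B, hB⟩ := hbdd g
    exact isLUB_ciSup ⟨B, by rintro _ ⟨n, rfl⟩; exact hB n x⟩
  have hmod' : ∀ g x y, (⨆ n, Q n g x) - (⨆ n, Q n g y) ≤ dist (κ x) (κ y) := by
    intro g x y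
    rw [sub_le_iff_le_add]
    refine ciSup_le fun n => ?_
    have h1 := hmod n g x y
    have h2 : Q n g y ≤ ⨆ n, Q n g y := (hlub g y).1 ⟨n, rfl⟩
    linarith
  let R : C(X, ℝ) → C(X, ℝ) := fun g =>
    ⟨fun x => ⨆ n, Q n g x, continuous_of_sub_le_dist hκ (hmod' g)⟩
  exact ⟨R, IsKantorovichMap.of_isLUB hQ hlub, hmod', hlub⟩

/-- The limits exist pointwise, are continuous by equicontinuity, and are uniform by Dini's theorem. -/
theorem exists_tendsto_of_antitone_of_equicontinuous (hκ : Continuous κ)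
    {Q : ℕ → C(X, ℝ) → C(X, ℝ)} (hQ : ∀ n, IsKantorovichMap (Q n))
    (hmod : ∀ n g x y, Q n g x - Q n g y ≤ dist (κ x) (κ y))
    (hanti : ∀ g, Antitone fun n => Q n g) (hbdd : ∀ g, ∃ B, ∀ n x, B ≤ Q n g x) :
    ∃ R : C(X, ℝ) → C(X, ℝ), IsKantorovichMap R ∧
      ∀ g, Tendsto (fun n => Q n g) atTop (𝓝 (R g)) := by
  have hlim : ∀ g x, Tendsto (fun n => Q n g x) atTop (𝓝 (⨅ n, Q n g x)) := fun g x => by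
    obtain ⟨B, hB⟩ := hbdd g
    exact tendsto_atTop_ciInf (fun m n hmn => hanti g hmn x)
      ⟨B, by rintro _ ⟨n, rfl⟩; exact hB n x⟩
  let R : C(X, ℝ) → C(X, ℝ) := fun g =>
    ⟨fun x => ⨅ n, Q n g x, continuous_of_sub_le_dist hκ fun x y =>
      le_of_tendsto' ((hlim g x).sub (hlim g y)) fun n => hmod n g x y⟩
  exact ⟨R, IsKantorovichMap.of_tendsto hQ hlim, fun g =>
    ContinuousMap.tendsto_of_antitone_of_pointwise (f := R g) (hanti g) (hlim g)⟩

variable [CompactSpace X]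

theorem le_add_const_norm_sub (g h : C(X, ℝ)) : g ≤ h + ContinuousMap.const X ‖g - h‖ :=
  ContinuousMap.le_def.2 fun x => by
    have := (g - h).apply_le_norm x
    simp only [ContinuousMap.sub_apply] at this
    simp only [ContinuousMap.add_apply, ContinuousMap.const_apply]
    linarith

theorem IsKantorovichMap.apply_le_add_norm {P : C(X, ℝ) → C(X, ℝ)} (hP : IsKantorovichMap P)
    (g h : C(X, ℝ)) (x : X) : P g x ≤ P h x + ‖g - h‖ := by
  have := ContinuousMap.le_def.1 (hP.mono (le_add_const_norm_sub g h)) x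
  rwa [hP.add_const] at this

theorem IsKantorovichMap.continuous {P : C(X, ℝ) → C(X, ℝ)} (hP : IsKantorovichMap P) :
    Continuous P := by
  refine (LipschitzWith.of_dist_le_mul (K := 1) fun g h => ?_).continuous
  rw [NNReal.coe_one, one_mul, dist_eq_norm, dist_eq_norm,
    ContinuousMap.norm_le _ (norm_nonneg _)]
  intro x
  have h1 := hP.apply_le_add_norm g h x
  have h2 := hP.apply_le_add_norm h g x
  rw [norm_sub_rev] at h2
  rw [ContinuousMap.sub_apply, Real.norm_eq_abs, abs_sub_le_iff]
  constructor <;> linarith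

/-- A Kantorovich map with equicontinuous range and bounded orbits admits a Kantorovich map
retracting `C(X)` onto its fixed points and dominating the upper limits of its orbits. The upper
limit `W g` of the orbit of `g` satisfies `W g ≤ T (W g)`, so the iterates of `T` on `W g` increase
to a fixed point. -/
theorem IsKantorovichMap.exists_retraction (hκ : Continuous κ) {T : C(X, ℝ) → C(X, ℝ)}
    (hT : IsKantorovichMap T) (hmod : ∀ g x y, T g x - T g y ≤ dist (κ x) (κ y)) {D : ℝ}
    (hD : ∀ n x, |T^[n] 0 x| ≤ D) :
    ∃ R : C(X, ℝ) → C(X, ℝ), IsKantorovichMap R ∧ (∀ f, T (R f) = R f) ∧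
      (∀ f, T f = f → R f = f) ∧
      ∀ g, ∀ ε > 0, ∀ᶠ n in atTop, T^[n] g ≤ R g + ContinuousMap.const X ε := by
  have hup : ∀ n g x, T^[n] g x ≤ D + ‖g‖ := fun n g x => by
    have := (hT.iterate n).apply_le_add_norm g 0 x
    rw [sub_zero] at this
    linarith [(abs_le.1 (hD n x)).2]
  have hlow : ∀ n g x, -(D + ‖g‖) ≤ T^[n] g x := fun n g x => by
    have := (hT.iterate n).apply_le_add_norm 0 g x
    rw [zero_sub, norm_neg] at this
    linarith [(abs_le.1 (hD n x)).1]
  have hmodn : ∀ n g x y, T^[n + 1] g x - T^[n + 1] g y ≤ dist (κ x) (κ y) := fun n g x y => by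
    rw [Function.iterate_succ_apply']
    exact hmod _ x y
  choose S hSK hSmod hS using fun n : ℕ => exists_isLUB_of_equicontinuous hκ
    (Q := fun k => T^[n + k + 1]) (fun k => hT.iterate _) (fun k => hmodn _)
    (fun g => ⟨D + ‖g‖, fun k => hup _ g⟩)
  have hTS : ∀ n k g, T^[n + k + 1] g ≤ S n g := fun n k g =>
    ContinuousMap.le_def.2 fun x => (hS n g x).1 ⟨k, rfl⟩
  have hSle : ∀ n g h, (∀ k, T^[n + k + 1] g ≤ h) → S n g ≤ h := fun n g h H =>
    ContinuousMap.le_def.2 fun x => (hS n g x).2 <| by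
      rintro _ ⟨k, rfl⟩
      exact H k x
  obtain ⟨W, hWK, hW⟩ := exists_tendsto_of_antitone_of_equicontinuous hκ hSK hSmod
    (fun g => antitone_nat_of_succ_le fun n => hSle _ _ _ fun k => by
      have := hTS n (k + 1) g
      rwa [show n + (k + 1) = n + 1 + k by ring] at this)
    (fun g => ⟨-(D + ‖g‖), fun n x => (hlow _ g x).trans (hTS n 0 g x)⟩)
  have hWT : ∀ g, W g ≤ T (W g) := fun g => by
    refine le_of_tendsto_continuousMap ((hW g).comp (tendsto_add_atTop_nat 1))
      ((hT.continuous.tendsto _).comp (hW g)) fun n => hSle _ _ _ fun k => ?_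
    have := hT.mono (hTS n k g)
    rw [← Function.iterate_succ_apply' T] at this
    rwa [show n + 1 + k + 1 = (n + k + 1).succ by omega]
  obtain ⟨R, hRK, -, hR⟩ := exists_isLUB_of_equicontinuous hκ
    (Q := fun m => T^[m + 1] ∘ W) (fun m => (hT.iterate _).comp hWK) (fun m g => hmodn _ _)
    (fun g => ⟨D + ‖W g‖, fun m => hup _ _⟩)
  have hmono : ∀ g, Monotone fun m => T^[m + 1] (W g) := fun g =>
    monotone_nat_of_le_succ fun m => by
      rw [Function.iterate_succ_apply T (m + 1)]
      exact (hT.iterate (m + 1)).mono (hWT g)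
  have hRlim : ∀ g, Tendsto (fun m => T^[m + 1] (W g)) atTop (𝓝 (R g)) := fun g =>
    ContinuousMap.tendsto_of_monotone_of_pointwise (hmono g) fun x =>
      tendsto_atTop_isLUB (fun m n hmn => hmono g hmn x) (hR g x)
  have hWR : ∀ g, W g ≤ R g := fun g => (hWT g).trans <|
    le_of_tendsto_continuousMap tendsto_const_nhds (hRlim g) fun n => hmono g n.zero_le
  refine ⟨R, hRK, fun f => ?_, fun f hf => ?_, fun g ε hε => ?_⟩
  · refine tendsto_nhds_unique ((hT.continuous.tendsto _).comp (hRlim f)) ?_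
    simpa only [Function.comp_def, Function.iterate_succ_apply'] using
      (hRlim f).comp (tendsto_add_atTop_nat 1)
  · have hfix : ∀ n, T^[n] f = f := fun n => Function.iterate_fixed hf n
    have hSf : ∀ n, S n f = f := fun n =>
      le_antisymm (hSle _ _ _ fun k => (hfix _).le) ((hfix _).ge.trans (hTS n 0 f))
    have hWf : W f = f := tendsto_nhds_unique (hW f) (by simp only [hSf]; exact tendsto_const_nhds)
    exact tendsto_nhds_unique (hRlim f)
      (by simp only [hWf, hfix]; exact tendsto_const_nhds)
  · have h1 : ∀ᶠ n in atTop, dist (S n g) (W g) < ε := (Metric.tendsto_nhds.1 (hW g)) ε hε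
    rw [← map_add_atTop_eq_nat 1, eventually_map]
    refine h1.mono fun n hn => ContinuousMap.le_def.2 fun x => ?_
    have h2 := ContinuousMap.le_def.1 (hTS n 0 g) x
    have h3 := ContinuousMap.le_def.1 (le_add_const_norm_sub (S n g) (W g)) x
    have h4 := ContinuousMap.le_def.1 (hWR g) x
    rw [dist_eq_norm] at hn
    simp only [ContinuousMap.add_apply, ContinuousMap.const_apply, add_zero] at h2 h3 ⊢
    linarith

end

/-! ### Operators dual to transfers -/

section

variable {X : Type*} [TopologicalSpace X] [MeasurableSpace X]

/-- `𝒮` and `P` are dual to each other: `∫ P g dμ` is the maximum over `ν` of `∫ g dν - 𝒮 μ ν`. -/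
def IsDualTo (𝒮 : ProbabilityMeasure X → ProbabilityMeasure X → EReal)
    (P : C(X, ℝ) → C(X, ℝ)) : Prop :=
  ∀ μ g, (∀ ν, (dualGap P μ ν g : EReal) ≤ 𝒮 μ ν) ∧ ∃ ν, 𝒮 μ ν ≤ dualGap P μ ν g

variable {𝒮 𝒯 : ProbabilityMeasure X → ProbabilityMeasure X → EReal} {P Q : C(X, ℝ) → C(X, ℝ)}

/-- Inf-convolution of transfers is dual to composition of operators. -/
theorem IsDualTo.infConv (hS : IsDualTo 𝒮 P) (hT : IsDualTo 𝒯 Q) :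
    IsDualTo (infConv 𝒮 𝒯) (P ∘ Q) := by
  refine fun μ g => ⟨fun ν => le_iInf fun σ => ?_, ?_⟩
  · rw [dualGap_comp μ σ ν, EReal.coe_add]
    exact add_le_add ((hS μ (Q g)).1 σ) ((hT σ g).1 ν)
  · obtain ⟨σ, hσ⟩ := (hS μ (Q g)).2
    obtain ⟨ν, hν⟩ := (hT σ g).2
    refine ⟨ν, iInf_le_of_le σ ?_⟩
    rw [dualGap_comp μ σ ν, EReal.coe_add]
    exact add_le_add hσ hν

theorem IsDualTo.selfConv (hT : IsDualTo 𝒯 P) (n : ℕ) :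
    IsDualTo (selfConv 𝒯 (n + 1)) P^[n + 1] := by
  induction n with
  | zero => exact hT
  | succ n ih => exact ih.infConv hT

end

section

variable {X : Type*} [MetricSpace X] [CompactSpace X] [MeasurableSpace X] [BorelSpace X]
  {𝒯 : ProbabilityMeasure X → ProbabilityMeasure X → EReal} {P : C(X, ℝ) → C(X, ℝ)}

/-- Evaluating duality at Dirac masses, `P g x` is a maximum of functionals of `g` of the form
`∫ g dν` minus a constant, with `ν` a probability measure. -/
theorem IsDualTo.isKantorovichMap (hT : IsDualTo 𝒯 P) : IsKantorovichMap P := by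
  have key : ∀ x g, ∃ ν : ProbabilityMeasure X, ∀ h,
      ∫ y, h y ∂(ν : Measure X) - P h x ≤ ∫ y, g y ∂(ν : Measure X) - P g x := by
    intro x g
    obtain ⟨ν, hν⟩ := (hT (diracProba x) g).2
    refine ⟨ν, fun h => ?_⟩
    have := EReal.coe_le_coe_iff.1 (((hT (diracProba x) h).1 ν).trans hν)
    simpa only [dualGap, integral_diracProba] using this
  refine ⟨fun g h hgh x => ?_, fun g c => ?_, fun a b g h ha hb hab x => ?_⟩
  · obtain ⟨ν, hν⟩ := key x g
    have h1 := hν h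
    have h2 := integral_continuousMap_mono ν hgh
    change P g x ≤ P h x
    linarith
  · ext x
    obtain ⟨ν, hν⟩ := key x g
    obtain ⟨ν', hν'⟩ := key x (g + ContinuousMap.const X c)
    have h1 := hν (g + ContinuousMap.const X c)
    have h2 := hν' g
    rw [integral_continuousMap_add, integral_continuousMap_const] at h1 h2
    simp only [ContinuousMap.add_apply (P g), ContinuousMap.const_apply]
    linarith
  · obtain ⟨ν, hν⟩ := key x (a • g + b • h)
    have h1 := mul_le_mul_of_nonneg_left (hν g) ha
    have h2 := mul_le_mul_of_nonneg_left (hν h) hb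
    simp only [integral_continuousMap_add, integral_continuousMap_smul] at h1 h2
    change P (a • g + b • h) x ≤ a * P g x + b * P h x
    have h3 : ∀ t : ℝ, a * t + b * t = t := fun t => by rw [← add_mul, hab, one_mul]
    have h4 := h3 (P (a • g + b • h) x)
    have h5 := h3 (a * ∫ y, g y ∂(ν : Measure X) + b * ∫ y, h y ∂(ν : Measure X))
    linarith

/-- The Kantorovich operator of a finite continuous transfer takes values in `C(X)`, with a modulus of
continuity common to all `g`, and its Legendre transform is attained. -/
theorem exists_continuousMap_dual (τ : ProbabilityMeasure X × ProbabilityMeasure X → ℝ)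
    (hτ : Continuous τ) (h𝒯 : ∀ μ ν, 𝒯 μ ν = (τ (μ, ν) : EReal)) {T : C(X, ℝ) → X → ℝ}
    (hT : IsBackwardKantorovichOperator 𝒯 T) :
    ∃ Tc : C(X, ℝ) → C(X, ℝ), (∀ g, T g = Tc g) ∧ IsDualTo 𝒯 Tc ∧
      ∃ κ : X → C(ProbabilityMeasure X, ℝ), Continuous κ ∧
        ∀ g x y, Tc g x - Tc g y ≤ dist (κ x) (κ y) := by
  have hmax : ∀ (μ : ProbabilityMeasure X) g,
      (∀ ν : ProbabilityMeasure X, ∫ x, g x ∂(ν : Measure X) - ∫ x, T g x ∂(μ : Measure X)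
        ≤ τ (μ, ν)) ∧
      ∃ ν : ProbabilityMeasure X, τ (μ, ν)
        ≤ ∫ x, g x ∂(ν : Measure X) - ∫ x, T g x ∂(μ : Measure X) := by
    intro μ g
    have hleg := hT.legendre_eq μ ⟨μ, by rw [h𝒯]; exact EReal.coe_ne_top _⟩ g
    simp only [legendre, h𝒯, ← EReal.coe_sub] at hleg
    constructor
    · intro ν
      have := (le_iSup (fun ν : ProbabilityMeasure X =>
        ((∫ x, g x ∂(ν : Measure X) - τ (μ, ν) : ℝ) : EReal)) ν).trans hleg.le
      have := EReal.coe_le_coe_iff.1 this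
      linarith
    · obtain ⟨ν, -, hν⟩ := (isCompact_univ (X := ProbabilityMeasure X)).exists_isMaxOn
        (f := fun ν : ProbabilityMeasure X => ∫ x, g x ∂(ν : Measure X) - τ (μ, ν))
        ⟨μ, trivial⟩ ((ProbabilityMeasure.continuous_integral_continuousMap g).sub
          (hτ.comp (Continuous.prodMk_right μ))).continuousOn
      refine ⟨ν, ?_⟩
      have := hleg.ge.trans (iSup_le fun σ => EReal.coe_le_coe_iff.2 (hν (Set.mem_univ σ)))
      have := EReal.coe_le_coe_iff.1 this
      linarith
  let κ : X → C(ProbabilityMeasure X, ℝ) := fun x => (ContinuousMap.curry ⟨τ, hτ⟩) (diracProba x)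
  have hκ : Continuous κ := (ContinuousMap.continuous _).comp continuous_diracProba
  have hdirac : ∀ g x, ∫ y, T g y ∂(diracProba x : Measure X) = T g x := fun g x =>
    integral_dirac (T g) x
  have hmod : ∀ g x y, T g x - T g y ≤ dist (κ x) (κ y) := by
    intro g x y
    obtain ⟨ν, hν⟩ := (hmax (diracProba x) g).2
    have h1 := (hmax (diracProba y) g).1 ν
    rw [hdirac] at hν h1
    have h2 := ContinuousMap.dist_apply_le_dist (f := κ x) (g := κ y) ν
    have h3 : τ (diracProba y, ν) - τ (diracProba x, ν) ≤ dist (κ x ν) (κ y ν) := by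
      rw [dist_comm]
      exact le_abs_self _
    linarith
  refine ⟨fun g => ⟨T g, continuous_of_sub_le_dist hκ (hmod g)⟩, fun g => rfl, fun μ g => ?_,
    κ, hκ, hmod⟩
  simp only [h𝒯, EReal.coe_le_coe_iff]
  exact hmax μ g

/-! ### Consequences of zero growth -/

theorem IsGrowthConstant.eventually_le {X : Type*} [MeasurableSpace X]
    {𝒯 : ProbabilityMeasure X → ProbabilityMeasure X → EReal} {ε : ℝ}
    (hℓ : IsGrowthConstant 𝒯 0) (hε : 0 < ε)
    (μ ν : ProbabilityMeasure X) :
    ∀ᶠ n : ℕ in atTop, ((-(ε * n) : ℝ) : EReal) ≤ selfConv 𝒯 n μ ν ∧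
      selfConv 𝒯 n μ ν ≤ ((ε * n : ℝ) : EReal) := by
  have h := hℓ μ ν
  filter_upwards [h.eventually (lt_mem_nhds (EReal.coe_lt_coe_iff.2 (neg_lt_zero.2 hε))),
    h.eventually (gt_mem_nhds (EReal.coe_lt_coe_iff.2 hε)), eventually_gt_atTop 0] with n h1 h2 hn
  have hn0 : (0 : EReal) < (n : EReal) := by exact_mod_cast hn
  have hnt : (n : EReal) ≠ ⊤ := EReal.natCast_ne_top n
  rw [EReal.lt_div_iff hn0 hnt] at h1
  rw [EReal.div_lt_iff hn0 hnt] at h2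
  rw [← neg_mul, EReal.coe_mul, EReal.coe_mul]
  exact ⟨h1.le, h2.le⟩

/-- If `P^[p] 0` were negative, the iterates of `P` on `0` would decrease linearly and the
self-convolutions would grow linearly. -/
theorem IsDualTo.exists_nonneg_iterate_zero [Nonempty X] (hT : IsDualTo 𝒯 P)
    (hℓ : IsGrowthConstant 𝒯 0) {p : ℕ} (hp : 0 < p) : ∃ x, 0 ≤ P^[p] 0 x := by
  by_contra! hneg
  have hP := hT.isKantorovichMap
  obtain ⟨x, -, hx⟩ := isCompact_univ.exists_isMaxOn Set.univ_nonempty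
    (P^[p] 0).continuous.continuousOn
  set m : ℝ := -P^[p] 0 x with hm
  have hm0 : 0 < m := neg_pos.2 (hneg x)
  have hle : P^[p] 0 ≤ ContinuousMap.const X (-m) := ContinuousMap.le_def.2 fun y => by
    simpa [hm] using hx (Set.mem_univ y)
  have hp' : (0 : ℝ) < p := by exact_mod_cast hp
  set μ : ProbabilityMeasure X := diracProba x
  -- The iterates of order `p * k` are at most `-k * m`, in size twice the
  -- allowed growth `(m / (2 * p)) * (p * k)`.
  have hev := (tendsto_id.const_mul_atTop' hp).eventually
    (hℓ.eventually_le (ε := m / (2 * p)) (by positivity) μ μ)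
  obtain ⟨k, hk, hk0⟩ := (hev.and (eventually_gt_atTop 0)).exists
  have hk' : (0 : ℝ) < k := by exact_mod_cast hk0
  obtain ⟨j, hj⟩ : ∃ j, p * k = j + 1 := Nat.exists_eq_succ_of_ne_zero (by positivity)
  have h1 := ((hT.selfConv j μ 0).1 μ)
  rw [← hj] at h1
  have h2 := EReal.coe_le_coe_iff.1 (h1.trans hk.2)
  have h3 := integral_continuousMap_mono μ ((hP.iterate p).iterate_zero_le hle k)
  rw [← Function.iterate_mul, integral_continuousMap_const] at h3
  rw [dualGap_zero] at h2
  have h4 : m / (2 * p) * ((p * k : ℕ) : ℝ) = k * m / 2 := by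
    push_cast
    field_simp
  simp only [id] at h2
  rw [h4] at h2
  have : 0 < k * m := by positivity
  linarith

/-- If `P^[p] 0` were positive, the iterates of `P` on `0` would increase linearly and the
self-convolutions would tend linearly to `-∞`. -/
theorem IsDualTo.exists_iterate_zero_nonpos [Nonempty X] (hT : IsDualTo 𝒯 P)
    (hℓ : IsGrowthConstant 𝒯 0) {M : ℝ} (hM : ∀ μ ν, 𝒯 μ ν ≤ (M : EReal)) {p : ℕ} (hp : 0 < p) :
    ∃ x, P^[p] 0 x ≤ 0 := by
  by_contra! hpos
  have hP := hT.isKantorovichMap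
  obtain ⟨x, -, hx⟩ := isCompact_univ.exists_isMinOn Set.univ_nonempty
    (P^[p] 0).continuous.continuousOn
  set m : ℝ := P^[p] 0 x with hm
  have hm0 : 0 < m := hpos x
  have hle : ContinuousMap.const X m ≤ P^[p] 0 := ContinuousMap.le_def.2 fun y =>
    hx (Set.mem_univ y)
  have hp' : (0 : ℝ) < p := by exact_mod_cast hp
  set μ : ProbabilityMeasure X := diracProba x
  have hev := ((tendsto_add_atTop_nat 1).comp (tendsto_id.const_mul_atTop' hp)).eventually
    (hℓ.eventually_le (ε := m / (2 * p)) (by positivity) μ μ)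
  -- Only one further transfer, at cost at most `M`, brings the chain to a prescribed endpoint.
  have hlarge : ∀ᶠ k : ℕ in atTop, M + m / (2 * p) < k * (m / 2) :=
    (tendsto_natCast_atTop_atTop.atTop_mul_const (half_pos hm0)).eventually_gt_atTop _
  obtain ⟨k, ⟨hk, hk1⟩, hk0⟩ := ((hev.and hlarge).and (eventually_gt_atTop 0)).exists
  obtain ⟨j, hj⟩ : ∃ j, p * k = j + 1 :=
    Nat.exists_eq_succ_of_ne_zero (Nat.mul_pos hp hk0).ne'
  obtain ⟨σ, hσ⟩ := (hT.selfConv j μ 0).2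
  have h1 : LinearTransfer.selfConv 𝒯 (j + 1 + 1) μ μ
      ≤ ((dualGap P^[j + 1] μ σ 0 + M : ℝ) : EReal) :=
    (iInf_le _ σ).trans (add_le_add hσ (hM σ μ))
  simp only [Function.comp, id] at hk
  rw [← hj] at h1
  have h2 := EReal.coe_le_coe_iff.1 (hk.1.trans h1)
  have h3 := integral_continuousMap_mono μ ((hP.iterate p).le_iterate_zero hle k)
  rw [← Function.iterate_mul, integral_continuousMap_const] at h3
  rw [dualGap_zero] at h2
  have h4 : m / (2 * p) * ((p * k + 1 : ℕ) : ℝ) = k * m / 2 + m / (2 * p) := by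
    push_cast
    field_simp
  rw [h4] at h2
  linarith

/-- Orbits are bounded: `P^[n] 0` takes values of both signs and has oscillation at most the diameter
of the range of `κ`. -/
theorem IsDualTo.exists_abs_iterate_zero_le [Nonempty X] (hT : IsDualTo 𝒯 P)
    (hℓ : IsGrowthConstant 𝒯 0) {M : ℝ} (hM : ∀ μ ν, 𝒯 μ ν ≤ (M : EReal))
    {Z : Type*} [PseudoMetricSpace Z] {κ : X → Z} (hκ : Continuous κ)
    (hmod : ∀ g x y, P g x - P g y ≤ dist (κ x) (κ y)) :
    ∃ D, ∀ n x, |P^[n] 0 x| ≤ D := by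
  have hb := (isCompact_range hκ).isBounded
  refine ⟨Metric.diam (Set.range κ), fun n x => ?_⟩
  rcases n.eq_zero_or_pos with rfl | hn
  · simpa using Metric.diam_nonneg
  have hosc : ∀ x y, P^[n] 0 x - P^[n] 0 y ≤ Metric.diam (Set.range κ) := fun x y => by
    obtain ⟨j, rfl⟩ := Nat.exists_eq_succ_of_ne_zero hn.ne'
    rw [Function.iterate_succ_apply']
    exact (hmod _ x y).trans (Metric.dist_le_diam_of_mem hb ⟨x, rfl⟩ ⟨y, rfl⟩)
  obtain ⟨y, hy⟩ := hT.exists_nonneg_iterate_zero hℓ hn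
  obtain ⟨z, hz⟩ := hT.exists_iterate_zero_nonpos hℓ hM hn
  rw [abs_le]
  constructor
  · linarith [hosc y x]
  · linarith [hosc x z]

end

/-! ### The limit transfer -/

section

variable {X : Type*} [MetricSpace X] [CompactSpace X] [MeasurableSpace X] [BorelSpace X]
  {𝒯 : ProbabilityMeasure X → ProbabilityMeasure X → EReal} {P R : C(X, ℝ) → C(X, ℝ)}

/-- The self-convolutions are bounded above uniformly in `n` as soon as the iterates of the dual
operator on `0` are bounded below: one optimal chain of `n + 1` transfers reaches some measure, and a
last transfer leads from there to any prescribed one. -/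
theorem IsDualTo.selfConv_le (hT : IsDualTo 𝒯 P) {M D : ℝ} (hM : ∀ μ ν, 𝒯 μ ν ≤ (M : EReal))
    (hD : ∀ n x, |P^[n] 0 x| ≤ D) (n : ℕ) (μ ν : ProbabilityMeasure X) :
    LinearTransfer.selfConv 𝒯 (n + 2) μ ν ≤ ((D + M : ℝ) : EReal) := by
  obtain ⟨σ, hσ⟩ := (hT.selfConv n μ 0).2
  refine (iInf_le _ σ).trans ?_
  rw [EReal.coe_add]
  refine add_le_add (hσ.trans (EReal.coe_le_coe_iff.2 ?_)) (hM σ ν)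
  have := integral_continuousMap_mono μ (g := ContinuousMap.const X (-D)) (h := P^[n + 1] 0)
    (ContinuousMap.le_def.2 fun x => (abs_le.1 (hD _ x)).1)
  rw [integral_continuousMap_const] at this
  rw [dualGap_zero]
  linarith

/-- If `R` dominates the upper limits of the orbits of the operator dual to `𝒯`, its dual gaps are
asymptotically below the self-convolutions of `𝒯`. -/
theorem IsDualTo.eventually_dualGap_sub_le (hT : IsDualTo 𝒯 P)
    (hR : ∀ g, ∀ ε > 0, ∀ᶠ n in atTop, P^[n] g ≤ R g + ContinuousMap.const X ε)
    (μ ν : ProbabilityMeasure X) (g : C(X, ℝ)) {ε : ℝ} (hε : 0 < ε) :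
    ∀ᶠ n in atTop, ((dualGap R μ ν g - ε : ℝ) : EReal) ≤ LinearTransfer.selfConv 𝒯 n μ ν := by
  filter_upwards [hR g ε hε, eventually_gt_atTop 0] with n hn hn0
  obtain ⟨j, rfl⟩ := Nat.exists_eq_succ_of_ne_zero hn0.ne'
  refine le_trans (EReal.coe_le_coe_iff.2 ?_) ((hT.selfConv j μ g).1 ν)
  have := integral_continuousMap_mono μ hn
  rw [integral_continuousMap_add, integral_continuousMap_const] at this
  simp only [dualGap]
  linarith

theorem IsDualTo.bddAbove_dualGap (hT : IsDualTo 𝒯 P) {M D : ℝ}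
    (hM : ∀ μ ν, 𝒯 μ ν ≤ (M : EReal)) (hD : ∀ n x, |P^[n] 0 x| ≤ D)
    (hR : ∀ g, ∀ ε > 0, ∀ᶠ n in atTop, P^[n] g ≤ R g + ContinuousMap.const X ε)
    (μ ν : ProbabilityMeasure X) : BddAbove (Set.range (dualGap R μ ν)) := by
  refine ⟨D + M + 1, ?_⟩
  rintro _ ⟨g, rfl⟩
  obtain ⟨n, hn⟩ := ((tendsto_add_atTop_nat 2).eventually
    (hT.eventually_dualGap_sub_le hR μ ν g one_pos)).exists
  have := EReal.coe_le_coe_iff.1 (hn.trans (hT.selfConv_le hM hD n μ ν))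
  linarith

theorem IsDualTo.dualCost_le_liminf (hT : IsDualTo 𝒯 P)
    (hR : ∀ g, ∀ ε > 0, ∀ᶠ n in atTop, P^[n] g ≤ R g + ContinuousMap.const X ε)
    (μ ν : ProbabilityMeasure X) :
    (dualCost R μ ν : EReal)
      ≤ liminf (fun n : ℕ => LinearTransfer.selfConv 𝒯 n μ ν) atTop := by
  refine EReal.ge_of_forall_gt_iff_ge.1 fun r hr => ?_
  obtain ⟨g, hg⟩ := exists_lt_of_lt_ciSup (EReal.coe_lt_coe_iff.1 hr)
  refine le_liminf_of_le ?_ ?_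
  · isBoundedDefault
  · have := hT.eventually_dualGap_sub_le hR μ ν g (sub_pos.2 hg)
    rwa [sub_sub_cancel] at this

/-- If every `R f` is a fixed point of the operator dual to `𝒯`, the transfer dual to `R` absorbs `𝒯`.
The minimax lemma applies since `𝒯` is convex in its second variable. -/
theorem IsDualTo.exists_add_dualCost_le (hT : IsDualTo 𝒯 P)
    {τ : ProbabilityMeasure X × ProbabilityMeasure X → ℝ} (hτ : Continuous τ)
    (h𝒯 : ∀ μ ν, 𝒯 μ ν = (τ (μ, ν) : EReal)) (hconv : IsProperConvexLSC 𝒯)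
    (hR : IsKantorovichMap R) (hPR : ∀ f, P (R f) = R f)
    (hB : ∀ μ ν, BddAbove (Set.range (dualGap R μ ν))) (μ ν : ProbabilityMeasure X) :
    ∃ σ, τ (μ, σ) + dualCost R σ ν ≤ dualCost R μ ν := by
  have key := exists_forall_le_of_forall_exists_le (c := dualCost R μ ν)
    (fun (σ : ProbabilityMeasure X) (g : C(X, ℝ)) => τ (μ, σ) + dualGap R σ ν g)
    (fun g => ((hτ.comp (Continuous.prodMk_right μ)).add
      ((continuous_dualGap g).comp (Continuous.prodMk_left ν))).lowerSemicontinuous)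
    (fun σ₁ σ₂ a b ha hb hab => by
      lift a to NNReal using ha
      lift b to NNReal using hb
      have hab : a + b = 1 := by exact_mod_cast hab
      obtain ⟨σ, hσ⟩ := exists_probabilityMeasure_eq_add hab σ₁ σ₂
      refine ⟨σ, fun g => ?_⟩
      have h1 := hconv.convex a b hab μ μ μ σ σ₁ σ₂ (toMeasure_eq_add_self hab μ) hσ
      rw [h𝒯, h𝒯, h𝒯, ← EReal.coe_mul, ← EReal.coe_mul, ← EReal.coe_add,
        EReal.coe_le_coe_iff] at h1
      rw [dualGap_of_eq_add hσ (toMeasure_eq_add_self hab ν)]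
      linarith)
    (fun σ => (concaveOn_const (τ (μ, σ)) convex_univ).add (hR.concaveOn_dualGap σ ν))
    (fun g => by
      obtain ⟨σ, hσ⟩ := (hT μ (R g)).2
      refine ⟨σ, ?_⟩
      rw [h𝒯, EReal.coe_le_coe_iff] at hσ
      have h1 := dualGap_le_dualCost (hB μ ν) g
      simp only [dualGap, hPR] at *
      linarith)
  obtain ⟨σ, hσ⟩ := key
  have : dualCost R σ ν ≤ dualCost R μ ν - τ (μ, σ) :=
    dualCost_le fun g => by linarith [hσ g]
  exact ⟨σ, by linarith⟩

theorem IsDualTo.isLeast_dualCost (hT : IsDualTo 𝒯 P)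
    {τ : ProbabilityMeasure X × ProbabilityMeasure X → ℝ} (hτ : Continuous τ)
    (h𝒯 : ∀ μ ν, 𝒯 μ ν = (τ (μ, ν) : EReal)) (hconv : IsProperConvexLSC 𝒯)
    (hR : IsKantorovichMap R) (hPR : ∀ f, P (R f) = R f)
    (hB : ∀ μ ν, BddAbove (Set.range (dualGap R μ ν))) (μ ν : ProbabilityMeasure X) :
    IsLeast (Set.range fun σ => 𝒯 μ σ + (dualCost R σ ν : EReal)) (dualCost R μ ν) := by
  have hle : ∀ σ, (dualCost R μ ν : EReal) ≤ 𝒯 μ σ + (dualCost R σ ν : EReal) := by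
    intro σ
    rw [h𝒯, ← EReal.coe_add, EReal.coe_le_coe_iff]
    refine dualCost_le fun g => ?_
    have h1 := (hT μ (R g)).1 σ
    rw [h𝒯, EReal.coe_le_coe_iff] at h1
    have h2 := dualGap_le_dualCost (hB σ ν) g
    simp only [dualGap, hPR] at *
    linarith
  obtain ⟨σ, hσ⟩ := hT.exists_add_dualCost_le hτ h𝒯 hconv hR hPR hB μ ν
  refine ⟨⟨σ, le_antisymm ?_ (hle σ)⟩, by rintro _ ⟨σ, rfl⟩; exact hle σ⟩
  simp only [h𝒯, ← EReal.coe_add]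
  exact EReal.coe_le_coe_iff.2 hσ

end

/-- A real-valued functional absorbed by `𝒮`, and by `𝒯` with the infimum attained, is absorbed by
`𝒮 ⋆ 𝒯`. Attainment replaces the distributivity of `+` over infima, which fails in `EReal`. -/
theorem infConv_infConv_eq {X : Type*} [MeasurableSpace X]
    {𝒮 𝒯 : ProbabilityMeasure X → ProbabilityMeasure X → EReal}
    {c : ProbabilityMeasure X → ProbabilityMeasure X → ℝ}
    (hS : ∀ μ ν, (c μ ν : EReal) = infConv 𝒮 (fun μ ν => (c μ ν : EReal)) μ ν)
    (hT : ∀ μ ν, IsLeast (Set.range fun σ => 𝒯 μ σ + (c σ ν : EReal)) (c μ ν))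
    (μ ν : ProbabilityMeasure X) :
    (c μ ν : EReal) = infConv (infConv 𝒮 𝒯) (fun μ ν => (c μ ν : EReal)) μ ν := by
  refine le_antisymm (le_iInf fun ρ => ?_) ?_
  · rw [← EReal.sub_le_iff_le_add (Or.inl (EReal.coe_ne_bot _)) (Or.inl (EReal.coe_ne_top _))]
    refine le_iInf fun σ => ?_
    rw [EReal.sub_le_iff_le_add (Or.inl (EReal.coe_ne_bot _)) (Or.inl (EReal.coe_ne_top _)),
      add_assoc, hS μ ν]
    exact (iInf_le _ σ).trans (add_le_add le_rfl ((hT σ ν).2 ⟨ρ, rfl⟩))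
  · rw [hS μ ν]
    refine le_iInf fun σ => ?_
    obtain ⟨ρ, hρ⟩ := (hT σ ν).1
    refine iInf_le_of_le ρ ?_
    dsimp only at hρ ⊢
    rw [← hρ, ← add_assoc]
    exact add_le_add (iInf_le _ σ) le_rfl

theorem infConv_selfConv_eq {X : Type*} [MeasurableSpace X]
    {𝒯 : ProbabilityMeasure X → ProbabilityMeasure X → EReal}
    {c : ProbabilityMeasure X → ProbabilityMeasure X → ℝ}
    (hT : ∀ μ ν, IsLeast (Set.range fun σ => 𝒯 μ σ + (c σ ν : EReal)) (c μ ν))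
    (n : ℕ) (μ ν : ProbabilityMeasure X) :
    (c μ ν : EReal) = infConv (selfConv 𝒯 (n + 1)) (fun μ ν => (c μ ν : EReal)) μ ν := by
  induction n generalizing μ ν with
  | zero => exact ((hT μ ν).isGLB.iInf_eq).symm
  | succ n ih => exact infConv_infConv_eq ih hT μ ν

end LinearTransfer

open LinearTransfer
theorem theorem2 {X : Type*} [MetricSpace X] [CompactSpace X] [MeasurableSpace X] [BorelSpace X]
    (𝒯 : ProbabilityMeasure X → ProbabilityMeasure X → EReal)
    (h𝒯 : IsBackwardLinearTransfer 𝒯) (hcont : IsWeakStarContinuous 𝒯)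
    (T : C(X, ℝ) → X → ℝ) (hT : IsBackwardKantorovichOperator 𝒯 T)
    (hℓ : IsGrowthConstant 𝒯 0) :
    ∃ (𝒯inf : ProbabilityMeasure X → ProbabilityMeasure X → EReal) (Tinf : C(X, ℝ) → C(X, ℝ)),
      IsBackwardLinearTransfer 𝒯inf ∧
      IsBackwardKantorovichOperator 𝒯inf (fun f => ⇑(Tinf f)) ∧
      (∀ f : C(X, ℝ), T (Tinf f) = ⇑(Tinf f)) ∧
      (∀ f : C(X, ℝ), Tinf (Tinf f) = Tinf f) ∧
      (∀ f : C(X, ℝ), T f = ⇑f ↔ Tinf f = f) ∧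
      (∀ n : ℕ, 1 ≤ n → ∀ μ ν, 𝒯inf μ ν = infConv (selfConv 𝒯 n) 𝒯inf μ ν) ∧
      (∀ μ ν, 𝒯inf μ ν = infConv 𝒯inf 𝒯inf μ ν) ∧
      (∀ μ ν, 𝒯inf μ ν ≤ liminf (fun n : ℕ => selfConv 𝒯 n μ ν) atTop) ∧
      (aubrySet 𝒯inf).Nonempty ∧
      (∀ μ ν, IsLeast ((fun σ => 𝒯inf μ σ + 𝒯inf σ ν) '' aubrySet 𝒯inf) (𝒯inf μ ν)) := by
  obtain ⟨hconv, -⟩ := h𝒯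
  obtain ⟨τ, hτ, h𝒯τ⟩ := hcont
  obtain ⟨μ₀, -⟩ := hconv.proper
  have := μ₀.nonempty
  obtain ⟨Tc, hTc, hdual, κ, hκ, hmod⟩ := exists_continuousMap_dual τ hτ h𝒯τ hT
  obtain ⟨M, hM⟩ : ∃ M : ℝ, ∀ μ ν, 𝒯 μ ν ≤ (M : EReal) := by
    obtain ⟨M, hM⟩ := (isCompact_range hτ).bddAbove
    exact ⟨M, fun μ ν => h𝒯τ μ ν ▸ EReal.coe_le_coe_iff.2 (hM ⟨_, rfl⟩)⟩
  obtain ⟨D, hD⟩ := hdual.exists_abs_iterate_zero_le hℓ hM hκ hmod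
  obtain ⟨R, hR, hTR, hfix, hdom⟩ :=
    hdual.isKantorovichMap.exists_retraction hκ hmod hD
  have hB := hdual.bddAbove_dualGap hM hD hdom
  have hRR : ∀ f, R (R f) = R f := fun f => hfix _ (hTR f)
  have hop := hR.isBackwardKantorovichOperator_dualCost hB
  have haubry : ∀ μ ν, IsLeast
      ((fun σ => (dualCost R μ σ : EReal) + (dualCost R σ ν : EReal)) ''
        aubrySet fun μ ν => (dualCost R μ ν : EReal)) (dualCost R μ ν) := by
    intro μ ν
    constructor
    · obtain ⟨σ, hσ, hsum⟩ := hR.exists_dualCost_self_eq_zero hRR hB μ ν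
      exact ⟨σ, EReal.coe_eq_zero.2 hσ, by simp only [← EReal.coe_add, hsum]⟩
    · rintro _ ⟨σ, -, rfl⟩
      simp only [← EReal.coe_add]
      exact EReal.coe_le_coe_iff.2 (dualCost_triangle hRR hB μ σ ν)
  refine ⟨fun μ ν => dualCost R μ ν, R, ⟨isProperConvexLSC_dualCost hB, _, hop⟩, hop,
    fun f => by rw [hTc, hTR], hRR, fun f => ⟨fun hf => hfix f ?_, fun hf => ?_⟩, fun n hn μ ν => ?_,
    fun μ ν => ?_, hdual.dualCost_le_liminf hdom, ?_, haubry⟩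
  · exact DFunLike.coe_injective ((hTc f).symm.trans hf)
  · rw [hTc, ← hf, hTR]
  · obtain ⟨n, rfl⟩ := Nat.exists_eq_add_of_le' hn
    exact infConv_selfConv_eq
      (hdual.isLeast_dualCost hτ h𝒯τ hconv hR hTR hB) n μ ν
  · refine le_antisymm (le_iInf fun σ => ?_) ?_
    · rw [← EReal.coe_add]
      exact EReal.coe_le_coe_iff.2 (dualCost_triangle hRR hB μ σ ν)
    · obtain ⟨σ, hσ⟩ := hR.exists_dualCost_add_eq hRR hB μ ν
      exact iInf_le_of_le σ (by rw [← EReal.coe_add, hσ])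
  · obtain ⟨σ, hσ, -⟩ := (haubry μ₀ μ₀).1
    exact ⟨σ, hσ⟩
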